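/- There is a simple closed curve in $\mathbb{R}^3$ (that is, a continuous injective map $\gamma\colon\mathbb{S}^1\to\mathbb{R}^3$ from the unit circle) whose range $\Gamma=\gamma(\mathbb{S}^1)$ satisfies $$\tfrac12(\Gamma+\Gamma)=[0,1]^3=\mathsf{co}(\Gamma),$$ where $\Gamma+\Gamma=\{x+y : x,y\in\Gamma\}$ is the Minkowski sum, $\tfrac12 A=\{\tfrac12 x : x\in A\}$ and $\mathsf{co}(\Gamma)$ is the convex hull of $\Gamma$. In particular, $\Gamma$ does not lie in any plane, so the answer to Ushakov's question (is there a simple closed curve in $\mathbb{R}^3$ whose range $\Gamma$ does not lie in any plane and satisfies $\frac12(\Gamma+\Gamma)=\mathsf{co}(\Gamma)$?) is positive. -/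

import Mathlib

open scoped Pointwise

/-- `γ` is a simple closed curve in `X`: a continuous injective map from the unit circle to `X`. -/
def IsSimpleClosedCurve {X : Type*} [TopologicalSpace X] (γ : Circle → X) : Prop :=
  Continuous γ ∧ Function.Injective γ

/-- The closed unit cube `[0,1]³` in Euclidean space `ℝ³`. -/
def unitCube : Set (EuclideanSpace ℝ (Fin 3)) :=
  {x | ∀ i, x i ∈ Set.Icc (0 : ℝ) 1}

/-!
Since `C + C = [0, 2]` for the Cantor set `C`, it suffices to find a simple closed curve in the cube
that passes through every point of `Cⁿ`.

The arc `t ↦ (x t, x (T t), …, x (Tⁿ⁻¹ t))` does this from one corner of the cube to the opposite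
one, where `T` is the zigzag map of the unit interval and `x` satisfies `x t = x (Tⁿ t) / 3` on the
first third, `x t = t` on the second and `x t = (2 + x (Tⁿ t)) / 3` on the last. On ternary
expansions without the digit `1`, `T` is the shift, so `x` reads off every `n`-th digit, and
interleaving digits produces a parameter for each point of `Cⁿ`. The arc is injective because two
parameters with the same image either coincide or are pushed apart by a factor of `3` under `T`,
again to two parameters with the same image.

The first two coordinates of `Cⁿ` lie in two intervals each, which gives four quarters. A copy of
the arc in one quarter, with segments attached at both ends, is reflected into the others to close
up.
-/

open Set Real
open scoped BoundedContinuousFunction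

theorem nonpos_of_exists_mul_le {α : Type*} {f : α → ℝ} {c K : ℝ} (hc : 1 < c)
    (hK : ∀ a, f a ≤ K) (h : ∀ a, 0 < f a → ∃ b, c * f a ≤ f b) (a : α) : f a ≤ 0 := by
  by_contra! ha
  have hbdd : BddAbove (range f) := ⟨K, forall_mem_range.2 hK⟩
  have hpos : 0 < ⨆ b, f b := ha.trans_le (le_ciSup hbdd a)
  have : Nonempty α := ⟨a⟩
  have hle : ⨆ b, f b ≤ (⨆ b, f b) / c := ciSup_le fun b => by
    rcases le_or_gt (f b) 0 with hb | hb
    · exact hb.trans (by positivity)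
    · obtain ⟨b', hb'⟩ := h b hb
      rw [le_div_iff₀' (by positivity)]
      exact hb'.trans (le_ciSup hbdd b')
  exact (div_lt_self hpos hc).not_ge hle

/-! ### Ternary expansions and the Cantor set -/

theorem ofDigits_eq_add_div {b : ℕ} (d : ℕ → Fin b) :
    ofDigits d = (d 0 + ofDigits fun k => d (k + 1)) / b := by
  rw [ofDigits_eq_sum_add_ofDigits d 1]
  simp only [Finset.range_one, Finset.sum_singleton, ofDigitsTerm, zero_add, pow_one]
  ring

theorem ofDigits_add_ofDigits_eq_mul {b c : ℕ} {d d' e : ℕ → Fin b}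
    (h : ∀ k, (d k + d' k : ℕ) = c * e k) : ofDigits d + ofDigits d' = c * ofDigits e := by
  simp only [ofDigits]
  rw [← summable_ofDigitsTerm.tsum_add summable_ofDigitsTerm,
    ← summable_ofDigitsTerm.tsum_mul_left]
  congr 1 with k
  have hk : (d k + d' k : ℝ) = c * e k := mod_cast h k
  simp only [ofDigitsTerm]
  rw [← add_mul, hk, mul_assoc]

theorem exists_ofDigits_eq_of_mem_cantorSet {a : ℝ} (ha : a ∈ cantorSet) :
    ∃ d : ℕ → Fin 3, (∀ k, d k ≠ 1) ∧ ofDigits d = a := by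
  rwa [cantorSet_eq_zero_two_ofDigits] at ha

theorem one_sub_mem_cantorSet {a : ℝ} (ha : a ∈ cantorSet) : 1 - a ∈ cantorSet := by
  obtain ⟨d, hd, rfl⟩ := exists_ofDigits_eq_of_mem_cantorSet ha
  have hsum : ofDigits d + ofDigits (fun k => (d k).rev) = (1 : ℕ) * ofDigits fun _ => Fin.last 2 :=
    ofDigits_add_ofDigits_eq_mul fun k => by simp only [Fin.val_rev, Fin.val_last]; lia
  rw [ofDigits_const_last_eq_one 2, Nat.cast_one, one_mul] at hsum
  rw [← hsum, add_sub_cancel_left]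
  exact ofDigits_zero_two_sequence_mem_cantorSet fun k => by grind

theorem exists_mem_cantorSet_add_eq {u : ℝ} (hu : u ∈ Icc (0 : ℝ) 1) :
    ∃ a ∈ cantorSet, ∃ b ∈ cantorSet, a + b = 2 * u := by
  obtain ⟨e, -, rfl⟩ := ofDigits_SurjOn (b := 3) (by norm_num) hu
  refine ⟨ofDigits fun k => if e k = 2 then (2 : Fin 3) else 0, ?_,
    ofDigits fun k => if e k = 0 then (0 : Fin 3) else 2, ?_, ?_⟩
  · exact ofDigits_zero_two_sequence_mem_cantorSet fun k => by grind
  · exact ofDigits_zero_two_sequence_mem_cantorSet fun k => by grind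
  · refine mod_cast ofDigits_add_ofDigits_eq_mul (c := 2) fun k => ?_
    generalize e k = j
    decide +revert

theorem exists_mem_cantorSet_abs_sub_half_eq {a : ℝ} (ha : a ∈ cantorSet) :
    ∃ b ∈ cantorSet, |a - 1 / 2| = 1 / 6 + b / 3 := by
  rw [cantorSet_eq_union_halves] at ha
  obtain ⟨b, hb, rfl⟩ | ⟨b, hb, rfl⟩ := ha
  all_goals have hmem := cantorSet_subset_unitInterval hb
  · refine ⟨1 - b, one_sub_mem_cantorSet hb, ?_⟩
    rw [abs_of_nonpos (by linarith [hmem.2])]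
    ring
  · refine ⟨b, hb, ?_⟩
    rw [abs_of_nonneg (by linarith [hmem.1])]
    ring

/-! ### The zigzag map -/

/-- The zigzag map: it maps each third of the unit interval affinely onto the unit interval,
reversing the middle one, so that on the Cantor set it deletes the first ternary digit. The formula
extends its outer two branches to the real line. -/
noncomputable def zigzag (t : ℝ) : ℝ :=
  min (3 * t) |3 * t - 2|

@[fun_prop]
theorem continuous_zigzag : Continuous zigzag := by
  unfold zigzag
  fun_prop

theorem zigzag_of_le {t : ℝ} (ht : t ≤ 1 / 3) : zigzag t = 3 * t := by
  grind [zigzag]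

theorem zigzag_of_ge {t : ℝ} (ht : 2 / 3 ≤ t) : zigzag t = 3 * t - 2 := by
  grind [zigzag]

theorem mapsTo_zigzag_Icc : MapsTo zigzag (Icc 0 1) (Icc 0 1) := by
  intro t ht
  grind [zigzag]

theorem mapsTo_zigzag_Iic : MapsTo zigzag (Iic 0) (Iic 0) := by
  intro t ht
  grind [zigzag]

theorem mapsTo_zigzag_Ici : MapsTo zigzag (Ici 1) (Ici 1) := by
  intro t ht
  grind [zigzag]

theorem isFixedPt_zigzag_zero : Function.IsFixedPt zigzag 0 := by
  norm_num [Function.IsFixedPt, zigzag]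

theorem isFixedPt_zigzag_one : Function.IsFixedPt zigzag 1 := by
  norm_num [Function.IsFixedPt, zigzag]

theorem zigzag_iterate_third {n : ℕ} (hn : n ≠ 0) : zigzag^[n] (1 / 3) = 1 := by
  obtain ⟨m, rfl⟩ := Nat.exists_eq_succ_of_ne_zero hn
  rw [Function.iterate_succ_apply, zigzag_of_le le_rfl, mul_one_div_cancel three_ne_zero,
    isFixedPt_zigzag_one.iterate m]

theorem zigzag_iterate_two_thirds {n : ℕ} (hn : n ≠ 0) : zigzag^[n] (2 / 3) = 0 := by
  obtain ⟨m, rfl⟩ := Nat.exists_eq_succ_of_ne_zero hn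
  rw [Function.iterate_succ_apply, zigzag_of_ge le_rfl, mul_div_cancel₀ _ three_ne_zero, sub_self,
    isFixedPt_zigzag_zero.iterate m]

theorem zigzag_ofDigits {d : ℕ → Fin 3} (hd : d 0 ≠ 1) :
    zigzag (ofDigits d) = ofDigits fun k => d (k + 1) := by
  have h₀ := ofDigits_nonneg fun k => d (k + 1)
  have h₁ := ofDigits_le_one fun k => d (k + 1)
  have hsplit := ofDigits_eq_add_div d
  obtain h | h : d 0 = 0 ∨ d 0 = 2 := by grind
  · norm_num [h] at hsplit
    rw [zigzag_of_le] <;> linarith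
  · norm_num [h] at hsplit
    rw [zigzag_of_ge] <;> linarith

theorem zigzag_iterate_ofDigits {d : ℕ → Fin 3} (hd : ∀ k, d k ≠ 1) (m : ℕ) :
    zigzag^[m] (ofDigits d) = ofDigits fun k => d (k + m) := by
  induction m with
  | zero => rfl
  | succ m ih =>
    rw [Function.iterate_succ_apply', ih, zigzag_ofDigits (d := fun k => d (k + m)) (hd _)]
    simp only [add_right_comm, add_assoc]

/-! ### The coordinate function of the arc -/

/-- The functional equation of the function `x` for which `t ↦ (x (zigzag^[i] t))`, `i < n`, is an
arc through all points of the `n`-th power of the Cantor set. Outside of the unit interval `x` is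
forced to be constant, see `IsCantorCoordinate.eq_zero` and `IsCantorCoordinate.eq_one`. -/
structure IsCantorCoordinate (n : ℕ) (x : ℝ →ᵇ ℝ) : Prop where
  of_le : ∀ t ≤ 1 / 3, x t = x (zigzag^[n] t) / 3
  of_mem : ∀ t ∈ Icc (1 / 3 : ℝ) (2 / 3), x t = t
  of_ge : ∀ t ≥ 2 / 3, x t = (2 + x (zigzag^[n] t)) / 3

theorem exists_eq_add_third_smul {α F : Type*} [TopologicalSpace α] [NormedAddCommGroup F]
    [NormedSpace ℝ F] [CompleteSpace F] (p : α →ᵇ F) (l r : C(α, α)) :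
    ∃ x : α →ᵇ F, ∀ t, x t = p t + (1 / 3 : ℝ) • (x (l t) + x (r t)) := by
  let Φ (x : α →ᵇ F) : α →ᵇ F := p + (1 / 3 : ℝ) • (x.compContinuous l + x.compContinuous r)
  have hΦ : ContractingWith (2 / 3) Φ := by
    refine ⟨by rw [← NNReal.coe_lt_coe]; norm_num, LipschitzWith.of_dist_le_mul fun x y => ?_⟩
    rw [BoundedContinuousFunction.dist_le (by positivity)]
    intro t
    calc dist (Φ x t) (Φ y t) = 1 / 3 * dist (x (l t) + x (r t)) (y (l t) + y (r t)) := by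
          change dist (p t + (1 / 3 : ℝ) • _) (p t + (1 / 3 : ℝ) • _) = _
          rw [dist_add_left, dist_smul₀, Real.norm_of_nonneg (by positivity)]
          rfl
      _ ≤ 1 / 3 * (dist x y + dist x y) := by
          grw [dist_add_add_le, x.dist_coe_le_dist, x.dist_coe_le_dist]
      _ = (2 / 3 : NNReal) * dist x y := by
          push_cast
          ring
  obtain ⟨x, hx⟩ : ∃ x, Φ x = x := ⟨_, hΦ.fixedPoint_isFixedPt⟩
  exact ⟨x, fun t => (DFunLike.congr_fun hx t).symm⟩

theorem exists_isCantorCoordinate {n : ℕ} (hn : n ≠ 0) : ∃ x, IsCantorCoordinate n x := by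
  have hp (t : ℝ) : max 0 (min (1 / 3) (t - 1 / 3)) ∈ Icc (0 : ℝ) 1 :=
    ⟨le_max_left _ _, max_le zero_le_one (min_le_of_left_le (by norm_num))⟩
  let p : ℝ →ᵇ ℝ := .mkOfBound ⟨fun t => max 0 (min (1 / 3) (t - 1 / 3)), by fun_prop⟩ 1
    fun s t => Real.dist_le_of_mem_Icc_01 (hp s) (hp t)
  let l : C(ℝ, ℝ) := ⟨fun t => zigzag^[n] (min t (1 / 3)), by fun_prop⟩
  let r : C(ℝ, ℝ) := ⟨fun t => zigzag^[n] (max t (2 / 3)), by fun_prop⟩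
  obtain ⟨x, hx⟩ := exists_eq_add_third_smul p l r
  simp only [smul_eq_mul, one_div_mul_eq_div] at hx
  have h_le {t : ℝ} (ht : t ≤ 1 / 3) : x t = (x (zigzag^[n] t) + x 0) / 3 := by
    have hpt : p t = 0 := max_eq_left (min_le_of_right_le (by linarith))
    rw [hx t, hpt, zero_add]
    simp only [l, r, ContinuousMap.coe_mk]
    rw [min_eq_left ht, max_eq_right (by linarith), zigzag_iterate_two_thirds hn]
  have h_mem {t : ℝ} (ht : t ∈ Icc (1 / 3 : ℝ) (2 / 3)) : x t = t - 1 / 3 + (x 1 + x 0) / 3 := by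
    have hpt : p t = t - 1 / 3 := (congr_arg (max 0) (min_eq_right (by linarith [ht.2]))).trans
      (max_eq_right (by linarith [ht.1]))
    rw [hx t, hpt]
    simp only [l, r, ContinuousMap.coe_mk]
    rw [min_eq_right ht.1, max_eq_right ht.2, zigzag_iterate_third hn, zigzag_iterate_two_thirds hn]
  have h_ge {t : ℝ} (ht : 2 / 3 ≤ t) : x t = 1 / 3 + (x 1 + x (zigzag^[n] t)) / 3 := by
    have hpt : p t = 1 / 3 :=
      (congr_arg (max 0) (min_eq_left (by linarith))).trans (max_eq_right (by norm_num))
    rw [hx t, hpt]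
    simp only [l, r, ContinuousMap.coe_mk]
    rw [min_eq_right (by linarith), max_eq_left ht, zigzag_iterate_third hn]
  have hx₀ : x 0 = 0 := by
    have := h_le (t := 0) (by norm_num)
    rw [(isFixedPt_zigzag_zero.iterate n).eq] at this
    linarith
  have hx₁ : x 1 = 1 := by
    have := h_ge (t := 1) (by norm_num)
    rw [(isFixedPt_zigzag_one.iterate n).eq] at this
    linarith
  refine ⟨x, fun t ht => ?_, fun t ht => ?_, fun t ht => ?_⟩
  · rw [h_le ht, hx₀, add_zero]
  · linarith [h_mem ht]
  · linarith [h_ge ht]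

namespace IsCantorCoordinate

variable {n : ℕ} {x : ℝ →ᵇ ℝ}

theorem nonneg (hx : IsCantorCoordinate n x) (t : ℝ) : 0 ≤ x t := by
  refine neg_nonpos.1 (nonpos_of_exists_mul_le (f := fun t => -x t) (c := 3) (by norm_num)
    (fun t => (neg_le_abs _).trans (x.norm_coe_le_norm t)) (fun t ht => ?_) t)
  have h_le := hx.of_le t
  have h_mem := hx.of_mem t
  have h_ge := hx.of_ge t
  exact ⟨zigzag^[n] t, by grind⟩

theorem le_one (hx : IsCantorCoordinate n x) (t : ℝ) : x t ≤ 1 := by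
  refine sub_nonpos.1 (nonpos_of_exists_mul_le (f := fun t => x t - 1) (c := 3) (K := ‖x‖)
    (by norm_num) (fun t => ?_) (fun t ht => ?_) t)
  · linarith [(le_abs_self _).trans (x.norm_coe_le_norm t)]
  · have h_le := hx.of_le t
    have h_mem := hx.of_mem t
    have h_ge := hx.of_ge t
    exact ⟨zigzag^[n] t, by grind⟩

theorem eq_zero (hx : IsCantorCoordinate n x) {t : ℝ} (ht : t ≤ 0) : x t = 0 := by
  refine (hx.nonneg t).antisymm' (nonpos_of_exists_mul_le (f := fun t : Iic (0 : ℝ) => x t)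
    (c := 3) (by norm_num) (fun t => hx.le_one t) (fun t _ => ?_) ⟨t, ht⟩)
  refine ⟨⟨zigzag^[n] t, mapsTo_zigzag_Iic.iterate n t.2⟩, ?_⟩
  linarith [hx.of_le t (by linarith [mem_Iic.1 t.2])]

theorem eq_one (hx : IsCantorCoordinate n x) {t : ℝ} (ht : 1 ≤ t) : x t = 1 := by
  refine (hx.le_one t).antisymm (sub_nonpos.1 (nonpos_of_exists_mul_le
    (f := fun t : Ici (1 : ℝ) => 1 - x t) (c := 3) (K := 1) (by norm_num)
    (fun t => by linarith [hx.nonneg t]) (fun t _ => ?_) ⟨t, ht⟩))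
  refine ⟨⟨zigzag^[n] t, mapsTo_zigzag_Ici.iterate n t.2⟩, ?_⟩
  linarith [hx.of_ge t (by linarith [mem_Ici.1 t.2])]

theorem eq_or_zigzag (hx : IsCantorCoordinate n x) {s t : ℝ} (h : x s = x t) :
    s = t ∨ |zigzag s - zigzag t| = 3 * |s - t| ∧ x (zigzag^[n] s) = x (zigzag^[n] t) := by
  have trichotomy (r : ℝ) : (r ≤ 1 / 3 ∧ x r ≤ 1 / 3) ∨
      (r ∈ Ioo (1 / 3 : ℝ) (2 / 3) ∧ x r = r) ∨ (2 / 3 ≤ r ∧ 2 / 3 ≤ x r) := by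
    have h_le := hx.of_le r
    have h_mem := hx.of_mem r
    have h_ge := hx.of_ge r
    have h₀ := hx.nonneg (zigzag^[n] r)
    have h₁ := hx.le_one (zigzag^[n] r)
    grind
  rcases trichotomy s with ⟨hs, hxs⟩ | ⟨⟨hs₁, hs₂⟩, hxs⟩ | ⟨hs, hxs⟩ <;>
  rcases trichotomy t with ⟨ht, hxt⟩ | ⟨⟨ht₁, ht₂⟩, hxt⟩ | ⟨ht, hxt⟩
  any_goals (exfalso; linarith)
  · right
    refine ⟨?_, by linarith [hx.of_le s hs, hx.of_le t ht]⟩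
    rw [zigzag_of_le hs, zigzag_of_le ht, ← mul_sub, abs_mul, abs_of_pos three_pos]
  · left
    linarith
  · right
    refine ⟨?_, by linarith [hx.of_ge s hs, hx.of_ge t ht]⟩
    rw [zigzag_of_ge hs, zigzag_of_ge ht, sub_sub_sub_cancel_right, ← mul_sub, abs_mul,
      abs_of_pos three_pos]

theorem ne_zero (hx : IsCantorCoordinate n x) : n ≠ 0 := by
  rintro rfl
  have h_le := hx.of_le (1 / 3) le_rfl
  have h_mem := hx.of_mem (1 / 3) (by norm_num)
  rw [Function.iterate_zero_apply] at h_le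
  linarith

theorem arc_injOn (hx : IsCantorCoordinate n x) :
    InjOn (fun t (i : Fin n) => x (zigzag^[i] t)) (Icc 0 1) := by
  intro s hs t ht hst
  let P : Set (ℝ × ℝ) := {p | p.1 ∈ Icc 0 1 ∧ p.2 ∈ Icc 0 1 ∧
    ∀ i < n, x (zigzag^[i] p.1) = x (zigzag^[i] p.2)}
  refine sub_eq_zero.1 (abs_nonpos_iff.1 (nonpos_of_exists_mul_le (c := 3) (K := 1)
    (f := fun p : P => |p.1.1 - p.1.2|) (by norm_num) ?_ ?_
    ⟨(s, t), hs, ht, fun i hi => congr_fun hst ⟨i, hi⟩⟩))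
  · rintro ⟨⟨s, t⟩, hs, ht, -⟩
    exact Real.dist_le_of_mem_Icc_01 hs ht
  · rintro ⟨⟨s, t⟩, hs, ht, hst⟩ hpos
    obtain h | ⟨hexp, hlast⟩ := hx.eq_or_zigzag (hst 0 (Nat.pos_of_ne_zero hx.ne_zero))
    · exact absurd h (sub_ne_zero.1 (abs_pos.1 hpos))
    refine ⟨⟨(zigzag s, zigzag t), mapsTo_zigzag_Icc hs, mapsTo_zigzag_Icc ht, fun i hi => ?_⟩,
      hexp.ge⟩
    obtain hi' | rfl := (Nat.succ_le_of_lt hi).lt_or_eq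
    · exact hst (i + 1) hi'
    · exact hlast

theorem apply_ofDigits (hx : IsCantorCoordinate n x) {d : ℕ → Fin 3} (hd : ∀ k, d k ≠ 1) :
    x (ofDigits d) = ofDigits fun k => d (k * n) := by
  refine sub_eq_zero.1 (abs_nonpos_iff.1 (nonpos_of_exists_mul_le (c := 3) (K := 1)
    (f := fun d : {d : ℕ → Fin 3 // ∀ k, d k ≠ 1} =>
      |x (ofDigits d.1) - ofDigits fun k => d.1 (k * n)|) (by norm_num) ?_ ?_ ⟨d, hd⟩))
  · rintro ⟨d, -⟩
    exact Real.dist_le_of_mem_Icc_01 ⟨hx.nonneg _, hx.le_one _⟩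
      ⟨ofDigits_nonneg _, ofDigits_le_one _⟩
  · rintro ⟨d, hd⟩ -
    refine ⟨⟨fun k => d (k + n), fun k => hd _⟩, ?_⟩
    have hx_split : x (ofDigits d) = (d 0 + x (ofDigits fun k => d (k + n))) / 3 := by
      have h_split := ofDigits_eq_add_div d
      have h₀ := ofDigits_nonneg fun k => d (k + 1)
      have h₁ := ofDigits_le_one fun k => d (k + 1)
      rw [← zigzag_iterate_ofDigits hd]
      obtain h | h : d 0 = 0 ∨ d 0 = 2 := by grind
      · norm_num [h] at h_split ⊢
        exact hx.of_le _ (by linarith)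
      · norm_num [h] at h_split ⊢
        exact hx.of_ge _ (by linarith)
    have h_split := ofDigits_eq_add_div fun k => d (k * n)
    simp only [add_mul, one_mul, zero_mul, Nat.cast_ofNat] at h_split
    rw [hx_split, h_split, ← sub_div, add_sub_add_left_eq_sub, abs_div,
      abs_of_pos (three_pos (α := ℝ)), mul_div_cancel₀ _ three_ne_zero]

theorem exists_arc_eq (hx : IsCantorCoordinate n x) {a : Fin n → ℝ} (ha : ∀ i, a i ∈ cantorSet) :
    ∃ t ∈ Icc (0 : ℝ) 1, ∀ i : Fin n, x (zigzag^[i] t) = a i := by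
  have hn : 0 < n := Nat.pos_of_ne_zero hx.ne_zero
  choose d hd hda using fun i => exists_ofDigits_eq_of_mem_cantorSet (ha i)
  let e (k : ℕ) : Fin 3 := d ⟨k % n, Nat.mod_lt k hn⟩ (k / n)
  have he (k : ℕ) : e k ≠ 1 := hd _ _
  refine ⟨ofDigits e, ⟨ofDigits_nonneg e, ofDigits_le_one e⟩, fun i => ?_⟩
  have hei (k : ℕ) : e (k * n + i) = d i k := by
    have hdiv : (k * n + i) / n = k := by
      rw [mul_comm, Nat.mul_add_div hn, Nat.div_eq_of_lt i.2, add_zero]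
    simp only [e, hdiv, Nat.mul_add_mod_of_lt i.2]
  rw [zigzag_iterate_ofDigits he, hx.apply_ofDigits fun k => he _, ← hda]
  simp only [hei]

end IsCantorCoordinate

/-! ### Reflecting a quarter arc -/

theorem continuous_sign_mul {X : Type*} [TopologicalSpace X] {c f : X → ℝ} (hc : Continuous c)
    (hf : Continuous f) (h : ∀ x, c x = 0 → f x = 0) :
    Continuous fun x => (SignType.sign (c x) : ℝ) * f x := by
  have h_ite : (fun x => (SignType.sign (c x) : ℝ) * f x) =
      fun x => if 0 ≤ c x then f x else -f x := by
    funext x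
    rcases lt_trichotomy (c x) 0 with hx | hx | hx
    · simp [hx, hx.not_ge]
    · simp [hx, h x hx]
    · simp [hx, hx.le]
  rw [h_ite]
  exact hf.if_le hf.neg continuous_const hc fun x hx => by rw [h x hx.symm, neg_zero]

theorem abs_sign_mul {c y : ℝ} (hy : 0 ≤ y) (h : c = 0 → y = 0) :
    |(SignType.sign c : ℝ) * y| = y := by
  rcases lt_trichotomy c 0 with hc | rfl | hc
  · simp [hc, abs_of_nonneg hy]
  · simp [h]
  · simp [hc, abs_of_nonneg hy]

theorem sign_sign_mul {c y : ℝ} (hy : 0 ≤ y) (h : y = 0 → c = 0) :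
    SignType.sign ((SignType.sign c : ℝ) * y) = SignType.sign c := by
  rcases hy.eq_or_lt with rfl | hy
  · simp [h]
  · rcases lt_trichotomy c 0 with hc | rfl | hc
    · simp [hc, hy]
    · simp
    · simp [hc, hy]

theorem re_sq_add_im_sq (z : Circle) : (z : ℂ).re ^ 2 + (z : ℂ).im ^ 2 = 1 := by
  rw [sq, sq, ← Complex.normSq_apply, Circle.normSq_coe]

variable {E : Type*}

/-- The parametrised curve `(f, g, h)` on the unit interval is an arc in the quarter of `ℝ × ℝ × E`
where the first two coordinates are nonnegative. It meets the walls of that quarter only at its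
endpoints, one on either wall, so that the reflected copies of it form a simple closed curve. -/
structure IsQuarterArc [TopologicalSpace E] (f g : ℝ → ℝ) (h : ℝ → E) : Prop where
  continuous_fst : Continuous f
  continuous_snd : Continuous g
  continuous_trd : Continuous h
  fst_nonneg : ∀ u ∈ Icc (0 : ℝ) 1, 0 ≤ f u
  snd_nonneg : ∀ u ∈ Icc (0 : ℝ) 1, 0 ≤ g u
  fst_eq_zero_iff : ∀ u ∈ Icc (0 : ℝ) 1, f u = 0 ↔ u = 0
  snd_eq_zero_iff : ∀ u ∈ Icc (0 : ℝ) 1, g u = 0 ↔ u = 1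
  injOn : InjOn (fun u => (f u, g u, h u)) (Icc 0 1)

/-- The closed curve made of the four copies of the arc `(f, g, h)` under reflection in the first
two coordinates. A point of the circle lies on the copy given by the signs of its coordinates and
has parameter `|z.re|` there. -/
noncomputable def reflectArc (f g : ℝ → ℝ) (h : ℝ → E) (z : Circle) : ℝ × ℝ × E :=
  (SignType.sign (z : ℂ).re * f |(z : ℂ).re|, SignType.sign (z : ℂ).im * g |(z : ℂ).re|,
    h |(z : ℂ).re|)

theorem abs_re_mem_Icc (z : Circle) : |(z : ℂ).re| ∈ Icc (0 : ℝ) 1 :=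
  ⟨abs_nonneg _, (Complex.abs_re_le_norm z).trans_eq (Circle.norm_coe z)⟩

theorem abs_re_eq_one_iff (z : Circle) : |(z : ℂ).re| = 1 ↔ (z : ℂ).im = 0 := by
  rw [← Complex.abs_re_eq_norm, Circle.norm_coe]

namespace IsQuarterArc

variable [TopologicalSpace E] {f g : ℝ → ℝ} {h : ℝ → E}

theorem fst_abs_re_eq_zero_iff (H : IsQuarterArc f g h) (z : Circle) :
    f |(z : ℂ).re| = 0 ↔ (z : ℂ).re = 0 := by
  rw [H.fst_eq_zero_iff _ (abs_re_mem_Icc z), abs_eq_zero]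

theorem snd_abs_re_eq_zero_iff (H : IsQuarterArc f g h) (z : Circle) :
    g |(z : ℂ).re| = 0 ↔ (z : ℂ).im = 0 := by
  rw [H.snd_eq_zero_iff _ (abs_re_mem_Icc z), abs_re_eq_one_iff]

theorem abs_reflectArc_fst (H : IsQuarterArc f g h) (z : Circle) :
    |(reflectArc f g h z).1| = f |(z : ℂ).re| :=
  abs_sign_mul (H.fst_nonneg _ (abs_re_mem_Icc z)) (H.fst_abs_re_eq_zero_iff z).2

theorem abs_reflectArc_snd (H : IsQuarterArc f g h) (z : Circle) :
    |(reflectArc f g h z).2.1| = g |(z : ℂ).re| :=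
  abs_sign_mul (H.snd_nonneg _ (abs_re_mem_Icc z)) (H.snd_abs_re_eq_zero_iff z).2

theorem sign_reflectArc_fst (H : IsQuarterArc f g h) (z : Circle) :
    SignType.sign (reflectArc f g h z).1 = SignType.sign (z : ℂ).re :=
  sign_sign_mul (H.fst_nonneg _ (abs_re_mem_Icc z)) (H.fst_abs_re_eq_zero_iff z).1

theorem sign_reflectArc_snd (H : IsQuarterArc f g h) (z : Circle) :
    SignType.sign (reflectArc f g h z).2.1 = SignType.sign (z : ℂ).im :=
  sign_sign_mul (H.snd_nonneg _ (abs_re_mem_Icc z)) (H.snd_abs_re_eq_zero_iff z).1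

theorem continuous_reflectArc (H : IsQuarterArc f g h) : Continuous (reflectArc f g h) := by
  have := H.continuous_fst
  have := H.continuous_snd
  have := H.continuous_trd
  refine (continuous_sign_mul (by fun_prop) (by fun_prop) fun z => ?_).prodMk
    ((continuous_sign_mul (by fun_prop) (by fun_prop) fun z => ?_).prodMk (by fun_prop))
  · exact (H.fst_abs_re_eq_zero_iff z).2
  · exact (H.snd_abs_re_eq_zero_iff z).2

theorem injective_reflectArc (H : IsQuarterArc f g h) :
    Function.Injective (reflectArc f g h) := by
  intro z w hzw
  have h_re : |(z : ℂ).re| = |(w : ℂ).re| := by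
    refine H.injOn (abs_re_mem_Icc z) (abs_re_mem_Icc w) (Prod.ext ?_ (Prod.ext ?_ ?_))
    · simp only [← H.abs_reflectArc_fst, hzw]
    · simp only [← H.abs_reflectArc_snd, hzw]
    · exact congr_arg (·.2.2) hzw
  have h_im : |(z : ℂ).im| = |(w : ℂ).im| := by
    rw [← sq_eq_sq_iff_abs_eq_abs] at h_re ⊢
    linarith [re_sq_add_im_sq z, re_sq_add_im_sq w]
  refine Circle.ext (Complex.ext ?_ ?_)
  · rw [← sign_mul_abs (z : ℂ).re, ← sign_mul_abs (w : ℂ).re, h_re, ← H.sign_reflectArc_fst, hzw,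
      H.sign_reflectArc_fst]
  · rw [← sign_mul_abs (z : ℂ).im, ← sign_mul_abs (w : ℂ).im, h_im, ← H.sign_reflectArc_snd, hzw,
      H.sign_reflectArc_snd]

theorem mem_range_reflectArc (H : IsQuarterArc f g h) {p : ℝ × ℝ × E} :
    p ∈ range (reflectArc f g h) ↔
      ∃ u ∈ Icc (0 : ℝ) 1, |p.1| = f u ∧ |p.2.1| = g u ∧ p.2.2 = h u := by
  constructor
  · rintro ⟨z, rfl⟩
    exact ⟨_, abs_re_mem_Icc z, H.abs_reflectArc_fst z, H.abs_reflectArc_snd z, rfl⟩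
  · rintro ⟨u, hu, h₁, h₂, h₃⟩
    have h_sq : 0 ≤ 1 - u ^ 2 := sub_nonneg.2 (pow_le_one₀ hu.1 hu.2)
    have hp₁ : p.1 = 0 ↔ u = 0 := by rw [← abs_eq_zero, h₁, H.fst_eq_zero_iff u hu]
    have hp₂ : p.2.1 = 0 ↔ √(1 - u ^ 2) = 0 := by
      rw [← abs_eq_zero, h₂, H.snd_eq_zero_iff u hu, sqrt_eq_zero h_sq, sub_eq_zero,
        eq_comm (a := (1 : ℝ)), pow_eq_one_iff_of_nonneg hu.1 two_ne_zero]
    have h_re : |SignType.sign p.1 * u| = u := abs_sign_mul hu.1 hp₁.1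
    have h_im : |SignType.sign p.2.1 * √(1 - u ^ 2)| = √(1 - u ^ 2) :=
      abs_sign_mul (sqrt_nonneg _) hp₂.1
    let c : ℂ := ⟨SignType.sign p.1 * u, SignType.sign p.2.1 * √(1 - u ^ 2)⟩
    have hc : ‖c‖ = 1 := by
      rw [← pow_eq_one_iff_of_nonneg (norm_nonneg c) two_ne_zero, Complex.sq_norm,
        Complex.normSq_apply, ← sq, ← sq, ← sq_abs, ← sq_abs (_ * √_), h_re, h_im, sq_sqrt h_sq,
        add_sub_cancel]
    refine ⟨⟨c, mem_sphere_zero_iff_norm.2 hc⟩, Prod.ext ?_ (Prod.ext ?_ ?_)⟩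
    · change SignType.sign (SignType.sign p.1 * u) * f |SignType.sign p.1 * u| = p.1
      rw [h_re, sign_sign_mul hu.1 hp₁.2, ← h₁, sign_mul_abs]
    · change SignType.sign (SignType.sign p.2.1 * √(1 - u ^ 2)) * g |SignType.sign p.1 * u| = p.2.1
      rw [h_re, sign_sign_mul (sqrt_nonneg _) hp₂.2, ← h₂, sign_mul_abs]
    · change h |SignType.sign p.1 * u| = p.2.2
      rw [h_re, h₃]

end IsQuarterArc

/-! ### The quarter arc through the Cantor points -/

/-- For a function `ρ` from the unit interval to itself that starts at `0`, the function on the unit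
interval that runs through a segment of slope `1 / 2` on the first third and then through a copy of
`ρ` scaled by `1 / 3`. -/
noncomputable def prolong (ρ : ℝ → ℝ) (u : ℝ) : ℝ :=
  (2 * ρ (3 * u - 1) + min (3 * u) 1) / 6

section Prolong

variable {ρ : ℝ → ℝ}

theorem continuous_prolong (hρ : Continuous ρ) : Continuous (prolong ρ) := by
  unfold prolong
  fun_prop

theorem prolong_nonneg (h₀ : ∀ t, 0 ≤ ρ t) {u : ℝ} (hu : 0 ≤ u) : 0 ≤ prolong ρ u := by
  have := h₀ (3 * u - 1)
  unfold prolong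
  positivity

theorem prolong_le_half (h₁ : ∀ t, ρ t ≤ 1) (u : ℝ) : prolong ρ u ≤ 1 / 2 := by
  unfold prolong
  linarith [h₁ (3 * u - 1), min_le_right (3 * u) 1]

theorem prolong_eq_zero_iff (h₀ : ∀ t, 0 ≤ ρ t) (h : ∀ t ≤ 0, ρ t = 0) {u : ℝ} (hu : 0 ≤ u) :
    prolong ρ u = 0 ↔ u = 0 := by
  have := h₀ (3 * u - 1)
  have := h (3 * u - 1)
  grind [prolong]

theorem eq_and_min_eq_of_prolong_eq (h₀ : ∀ t, 0 ≤ ρ t) (h : ∀ t ≤ 0, ρ t = 0) {u v : ℝ}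
    (huv : prolong ρ u = prolong ρ v) :
    ρ (3 * u - 1) = ρ (3 * v - 1) ∧ min (3 * u) 1 = min (3 * v) 1 := by
  have := h₀ (3 * u - 1)
  have := h₀ (3 * v - 1)
  have := h (3 * u - 1)
  have := h (3 * v - 1)
  grind [prolong]

theorem prolong_one_add_div {t : ℝ} (ht : 0 ≤ t) : prolong ρ ((1 + t) / 3) = 1 / 6 + ρ t / 3 := by
  rw [prolong, mul_div_cancel₀ _ three_ne_zero, add_sub_cancel_left, min_eq_right (by linarith)]
  ring

end Prolong

namespace IsCantorCoordinate

variable {n : ℕ} {x : ℝ →ᵇ ℝ}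

theorem isQuarterArc (hx : IsCantorCoordinate (n + 2) x) :
    IsQuarterArc (prolong x) (fun u => prolong (fun t => 1 - x (zigzag (1 - t))) (1 - u))
      (fun u (i : Fin n) => x (zigzag^[i + 2] (3 * u - 1))) := by
  have hx₀ (t : ℝ) (ht : t ≤ 0) : x t = 0 := hx.eq_zero ht
  have hy_nonneg (t : ℝ) : 0 ≤ 1 - x (zigzag (1 - t)) := sub_nonneg.2 (hx.le_one _)
  have hy₀ (t : ℝ) (ht : t ≤ 0) : 1 - x (zigzag (1 - t)) = 0 := by
    rw [hx.eq_one (mapsTo_zigzag_Ici (by grind)), sub_self]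
  -- The second coordinate vanishes at the end of the arc, hence `1 - u` and the reversed `ρ`.
  refine
    { continuous_fst := continuous_prolong x.continuous
      continuous_snd := (continuous_prolong (by fun_prop)).comp (by fun_prop)
      continuous_trd := by fun_prop
      fst_nonneg := fun u hu => prolong_nonneg hx.nonneg hu.1
      snd_nonneg := fun u hu => prolong_nonneg hy_nonneg (sub_nonneg.2 hu.2)
      fst_eq_zero_iff := fun u hu => prolong_eq_zero_iff hx.nonneg hx₀ hu.1
      snd_eq_zero_iff := fun u hu => by
        rw [prolong_eq_zero_iff hy_nonneg hy₀ (sub_nonneg.2 hu.2), sub_eq_zero, eq_comm]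
      injOn := fun u hu v hv huv => ?_ }
  simp only [Prod.mk.injEq] at huv
  obtain ⟨h₁, h₂, h₃⟩ := huv
  obtain ⟨hx_eq, h_min⟩ := eq_and_min_eq_of_prolong_eq hx.nonneg hx₀ h₁
  obtain ⟨hy_eq, h_min'⟩ := eq_and_min_eq_of_prolong_eq hy_nonneg hy₀ h₂
  by_cases h_mid : u ∈ Icc (1 / 3 : ℝ) (2 / 3) ∧ v ∈ Icc (1 / 3 : ℝ) (2 / 3)
  · have h_arc : 3 * u - 1 = 3 * v - 1 := by
      refine hx.arc_injOn (by grind) (by grind) (funext (Fin.cases hx_eq (Fin.cases ?_ ?_)))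
      · have h_sub (r : ℝ) : 1 - (3 * (1 - r) - 1) = 3 * r - 1 := by ring
        rw [h_sub, h_sub] at hy_eq
        exact sub_right_injective hy_eq
      · exact fun i => congr_fun h₃ i
    linarith
  · grind

theorem exists_quarterArc_eq (hx : IsCantorCoordinate (n + 2) x) {a : Fin (n + 2) → ℝ}
    (ha : ∀ i, a i ∈ cantorSet) :
    ∃ u ∈ Icc (0 : ℝ) 1, prolong x u = 1 / 6 + a 0 / 3 ∧
      prolong (fun t => 1 - x (zigzag (1 - t))) (1 - u) = 1 / 6 + (1 - a 1) / 3 ∧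
      (fun i : Fin n => x (zigzag^[i + 2] (3 * u - 1))) = fun i => a i.succ.succ := by
  obtain ⟨t, ht, hta⟩ := hx.exists_arc_eq ha
  refine ⟨(1 + t) / 3, by grind, ?_, ?_, ?_⟩
  · rw [prolong_one_add_div ht.1]
    simp [← hta]
  · rw [show 1 - (1 + t) / 3 = (1 + (1 - t)) / 3 by ring, prolong_one_add_div (sub_nonneg.2 ht.2)]
    simp [← hta]
  · funext i
    rw [mul_div_cancel₀ _ three_ne_zero, add_sub_cancel_left, ← hta]
    rfl

end IsCantorCoordinate

/-! ### The curve in the cube -/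

/-- The coordinates of `ℝⁿ⁺²` for which the planes of reflection are the planes `p 0 = 1 / 2` and
`p 1 = 1 / 2` through the centre of the unit cube. -/
noncomputable def centredCoordinates (n : ℕ) :
    EuclideanSpace ℝ (Fin (n + 2)) ≃ₜ ℝ × ℝ × (Fin n → ℝ) where
  toFun p := (p 0 - 1 / 2, p 1 - 1 / 2, fun i => p i.succ.succ)
  invFun q := WithLp.toLp 2 (Fin.cons (q.1 + 1 / 2) (Fin.cons (q.2.1 + 1 / 2) q.2.2))
  left_inv p := by
    ext i
    refine Fin.cases ?_ (Fin.cases ?_ fun i => ?_) i <;> simp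
  right_inv q := by simp [Fin.cons_one]
  continuous_toFun := by fun_prop
  continuous_invFun := (PiLp.continuous_toLp 2 _).comp <|
    Continuous.finCons (by fun_prop) (Continuous.finCons (by fun_prop) (by fun_prop))

/-- The closed unit cube in Euclidean space, of which `unitCube` is the three-dimensional case. -/
def closedCube (ι : Type*) : Set (EuclideanSpace ℝ ι) :=
  {x | ∀ i, x i ∈ Icc (0 : ℝ) 1}

theorem exists_isSimpleClosedCurve_subset_closedCube (n : ℕ) :
    ∃ γ : Circle → EuclideanSpace ℝ (Fin (n + 2)), IsSimpleClosedCurve γ ∧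
      range γ ⊆ closedCube _ ∧ ∀ p, (∀ i, p i ∈ cantorSet) → p ∈ range γ := by
  obtain ⟨x, hx⟩ := exists_isCantorCoordinate (Nat.succ_ne_zero (n + 1))
  have H := hx.isQuarterArc
  let e := centredCoordinates n
  refine ⟨e.symm ∘ reflectArc _ _ _, ⟨e.symm.continuous.comp H.continuous_reflectArc,
    e.symm.injective.comp H.injective_reflectArc⟩, ?_, fun p hp => ?_⟩
  · rw [range_comp, image_subset_iff]
    intro q hq
    obtain ⟨u, -, h₁, h₂, h₃⟩ := H.mem_range_reflectArc.1 hq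
    have hq₁ : |q.1| ≤ 1 / 2 := h₁.trans_le (prolong_le_half hx.le_one u)
    have hq₂ : |q.2.1| ≤ 1 / 2 :=
      h₂.trans_le (prolong_le_half (fun t => sub_le_self 1 (hx.nonneg _)) (1 - u))
    rw [abs_le] at hq₁ hq₂
    refine Fin.cases ?_ (Fin.cases ?_ fun i => ?_)
    · change q.1 + 1 / 2 ∈ Icc (0 : ℝ) 1
      constructor <;> linarith
    · change q.2.1 + 1 / 2 ∈ Icc (0 : ℝ) 1
      constructor <;> linarith
    · change q.2.2 i ∈ Icc (0 : ℝ) 1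
      rw [h₃]
      exact ⟨hx.nonneg _, hx.le_one _⟩
  · obtain ⟨a, ha, hpa⟩ := exists_mem_cantorSet_abs_sub_half_eq (hp 0)
    obtain ⟨b, hb, hpb⟩ := exists_mem_cantorSet_abs_sub_half_eq (hp 1)
    let c : Fin (n + 2) → ℝ := Fin.cons a (Fin.cons (1 - b) fun i => p i.succ.succ)
    have hc : ∀ i, c i ∈ cantorSet :=
      Fin.cases ha (Fin.cases (one_sub_mem_cantorSet hb) fun i => hp i.succ.succ)
    obtain ⟨u, hu, h₁, h₂, h₃⟩ := hx.exists_quarterArc_eq hc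
    rw [show c 1 = 1 - b from rfl, sub_sub_cancel] at h₂
    obtain ⟨z, hz⟩ := (H.mem_range_reflectArc (p := e p)).2
      ⟨u, hu, hpa.trans h₁.symm, hpb.trans h₂.symm, h₃.symm⟩
    exact ⟨z, e.symm_apply_eq.2 hz⟩

theorem closedCube_subset_half_smul_add_self {ι : Type*} {s : Set (EuclideanSpace ℝ ι)}
    (hs : ∀ p : EuclideanSpace ℝ ι, (∀ i, p i ∈ cantorSet) → p ∈ s) :
    closedCube ι ⊆ (1 / 2 : ℝ) • (s + s) := by
  intro p hp
  choose a ha b hb hab using fun i => exists_mem_cantorSet_add_eq (hp i)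
  refine ⟨_, add_mem_add (hs (WithLp.toLp 2 a) ha) (hs (WithLp.toLp 2 b) hb), ?_⟩
  ext i
  change 1 / 2 * (a i + b i) = p i
  rw [hab, one_div, inv_mul_cancel_left₀ two_ne_zero]

theorem convex_closedCube (ι : Type*) : Convex ℝ (closedCube ι) :=
  fun _ hp _ hq _ _ ha hb hab i => convex_Icc 0 1 (hp i) (hq i) ha hb hab

theorem interior_closedCube_nonempty (ι : Type*) [Finite ι] :
    (interior (closedCube ι)).Nonempty := by
  have h_open : IsOpen (WithLp.ofLp ⁻¹' univ.pi fun _ => Ioo 0 1 : Set (EuclideanSpace ℝ ι)) :=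
    (isOpen_set_pi finite_univ fun _ _ => isOpen_Ioo).preimage (PiLp.continuous_ofLp 2 _)
  refine ⟨WithLp.toLp 2 fun _ => 1 / 2, mem_interior.2 ⟨_, fun p hp i => ?_, h_open, ?_⟩⟩
  · exact Ioo_subset_Icc_self (hp i (mem_univ i))
  · norm_num

theorem half_smul_add_self_subset_convexHull {V : Type*} [AddCommGroup V] [Module ℝ V] (s : Set V) :
    (1 / 2 : ℝ) • (s + s) ⊆ convexHull ℝ s := by
  rintro _ ⟨_, ⟨a, ha, b, hb, rfl⟩, rfl⟩
  simpa only [smul_add] using convex_convexHull ℝ s (subset_convexHull ℝ s ha)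
    (subset_convexHull ℝ s hb) (by norm_num) (by norm_num) (add_halves 1)

theorem not_coplanar_of_affineSpan_eq_top {V : Type*} [AddCommGroup V] [Module ℝ V]
    (hV : 2 < Module.finrank ℝ V) {s : Set V} (hs : affineSpan ℝ s = ⊤) : ¬ Coplanar ℝ s := by
  rw [Coplanar, AffineSubspace.vectorSpan_eq_top_of_affineSpan_eq_top ℝ V V hs, rank_top, not_le]
  exact mod_cast Module.lt_rank_of_lt_finrank hV

theorem theorem2_general {n : ℕ} (hn : 2 ≤ n) :
    ∃ γ : Circle → EuclideanSpace ℝ (Fin n), IsSimpleClosedCurve γ ∧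
      (1 / 2 : ℝ) • (range γ + range γ) = closedCube (Fin n) ∧
      closedCube (Fin n) = convexHull ℝ (range γ) ∧
      affineSpan ℝ (range γ) = ⊤ := by
  obtain ⟨m, rfl⟩ := Nat.exists_eq_add_of_le' hn
  obtain ⟨γ, hγ, h_cube, h_cantor⟩ := exists_isSimpleClosedCurve_subset_closedCube m
  have h_half := closedCube_subset_half_smul_add_self h_cantor
  have h_hull := half_smul_add_self_subset_convexHull (range γ)
  have h_hull_cube : convexHull ℝ (range γ) ⊆ closedCube _ :=
    convexHull_min h_cube (convex_closedCube _)
  have h_eq : closedCube _ = convexHull ℝ (range γ) := (h_half.trans h_hull).antisymm h_hull_cube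
  refine ⟨γ, hγ, (h_hull.trans h_hull_cube).antisymm h_half, h_eq, ?_⟩
  rw [← interior_convexHull_nonempty_iff_affineSpan_eq_top, ← h_eq]
  exact interior_closedCube_nonempty _

theorem theorem2 :
    ∃ γ : Circle → EuclideanSpace ℝ (Fin 3), IsSimpleClosedCurve γ ∧
      (1 / 2 : ℝ) • (Set.range γ + Set.range γ) = unitCube ∧
      unitCube = convexHull ℝ (Set.range γ) ∧
      ¬ Coplanar ℝ (Set.range γ) := by
  obtain ⟨γ, hγ, h_half, h_hull, h_span⟩ := theorem2_general (Nat.le_succ 2)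
  exact ⟨γ, hγ, h_half, h_hull, not_coplanar_of_affineSpan_eq_top (by simp) h_span⟩
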